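/- For a group $G$, let the \emph{Hirsch length} $h(G)$ be the number of infinite cyclic factors in a finite subnormal series of $G$ all of whose factors are infinite cyclic or periodic (this number does not depend on the series; put $h(G)=\infty$ if no such series exists). Let $G\otimes G$ be the nonabelian tensor square of $G$, i.e. the group generated by symbols $x\otimes y$ ($x,y\in G$) subject to the relations $$xy\otimes z=({}^{x}y\otimes{}^{x}z)(x\otimes z),\qquad x\otimes zt=(x\otimes z)({}^{z}x\otimes{}^{z}t)\qquad(x,y,z,t\in G),$$ where ${}^{x}y=xyx^{-1}$. Let $M(G)=H_2(G,\mathbb{Z})$ be the Schur multiplier of $G$, and write $f(h(G))=h(G\otimes G)-h(G)$. Let $S$ be a solvable group and let $c\ge 0$ be an integer such that $f(h(S))=c\,h(S)$, that is, $h(S)$ and $h(S\otimes S)$ are finite and $h(S\otimes S)-h(S)=c\,h(S)$. Then $$h(M(S))\le h(S)^2+(c+1)\,h(S).$$ If moreover $S$ is finite, then equality holds: $h(M(S))=h(S)^2+(c+1)\,h(S)$. -/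

import Mathlib

universe u

/-- `HirschSeries H n`: the subgroup `H` of `G` is reached from the trivial subgroup by a finite
series of subgroups, each normal in the next one, in which every factor is periodic (a torsion
group) or infinite cyclic, exactly `n` of the factors being counted as infinite cyclic. -/
inductive HirschSeries {G : Type u} [Group G] : Subgroup G → ℕ → Prop
  | bot : HirschSeries ⊥ 0
  | periodic {H K : Subgroup G} {n : ℕ} (hHK : H ≤ K) [hN : (H.subgroupOf K).Normal]
      (htor : IsMulTorsion (K ⧸ H.subgroupOf K))
      (hser : HirschSeries H n) : HirschSeries K n
  | infiniteCyclic {H K : Subgroup G} {n : ℕ} (hHK : H ≤ K) [hN : (H.subgroupOf K).Normal]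
      (hcyc : IsCyclic (K ⧸ H.subgroupOf K)) (hinf : Infinite (K ⧸ H.subgroupOf K))
      (hser : HirschSeries H n) : HirschSeries K (n + 1)

/-- The Hirsch length (torsion-free rank) of a group: the number of infinite cyclic factors in a
finite subnormal series whose factors are infinite cyclic or periodic. This number is the same
for all such series of the group, so that the infimum selects it; if there is no such series, the
Hirsch length is infinite (`⊤`). -/
noncomputable def hirschLength (G : Type u) [Group G] : ℕ∞ :=
  ⨅ n ∈ {n : ℕ | HirschSeries (⊤ : Subgroup G) n}, (n : ℕ∞)

/-- The defining relators of the nonabelian tensor square, `(x, y)` standing for the symbol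
`x ⊗ y`, where `G` acts on itself by conjugation, `ˣy = x y x⁻¹`:
`xy ⊗ z = (ˣy ⊗ ˣz)(x ⊗ z)` and `x ⊗ zt = (x ⊗ z)(ᶻx ⊗ ᶻt)`. -/
def tensorSquareRelators (G : Type u) [Group G] : Set (FreeGroup (G × G)) :=
  {r | ∃ x y z : G, r = FreeGroup.of (x * y, z) *
      (FreeGroup.of (x * y * x⁻¹, x * z * x⁻¹) * FreeGroup.of (x, z))⁻¹} ∪
  {r | ∃ x z t : G, r = FreeGroup.of (x, z * t) *
      (FreeGroup.of (x, z) * FreeGroup.of (z * x * z⁻¹, z * t * z⁻¹))⁻¹}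

/-- The nonabelian tensor square `G ⊗ G`. -/
abbrev NonabelianTensorSquare (G : Type u) [Group G] : Type u :=
  PresentedGroup (tensorSquareRelators G)

/-- The Schur multiplier `M(G) = H₂(G, ℤ)`, the second homology group with trivial integral
coefficients. The integers are lifted to the universe of `G`. -/
abbrev SchurMultiplier (G : Type u) [Group G] : Type u :=
  groupHomology (Rep.trivial (ULift.{u} ℤ) G (ULift.{u} ℤ)) 2

/-- The quantity `f(h(G)) = h(G ⊗ G) - h(G)`. It is taken in `EReal`, so that it is an integer
exactly if both Hirsch lengths are finite; otherwise it is `⊤` or `⊥`, and it is `⊥` whenever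
`h(G)` is infinite. -/
noncomputable def tensorSquareGrowth (G : Type u) [Group G] : EReal :=
  ((hirschLength (NonabelianTensorSquare G) : ENNReal) : EReal) -
    ((hirschLength G : ENNReal) : EReal)

/-! The core is h(M(G)) ≤ h(G ⊗ G), for every group G. The bar 2-chains modulo 2-boundaries carry a
tautological 2-cocycle, which defines a central extension E of G. Modulo [E, E] a kernel element
depends only on its boundary, so cycles land in [E, E], and M(G) embeds there
(`incl_mem_commutator`). Commutators in E depend only on images in G, so x ⊗ y ↦ [s x, s y] maps G ⊗
G onto [E, E]. Hirsch length does not grow under subgroups or quotients, and the growth hypothesis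
gives h(G ⊗ G) = (c + 1) h(G). The square term is slack; for finite groups both sides vanish. -/

variable {G G' : Type u} [Group G] [Group G']

/-! ### Monotonicity of the Hirsch length -/

theorem IsMulTorsion.of_injective {f : G →* G'} (hf : Function.Injective f)
    (h : IsMulTorsion G') : IsMulTorsion G :=
  fun x => hf.isOfFinOrder_iff.1 (h (f x))

/-- Subgroups and quotients of an infinite cyclic factor are cyclic but may be finite; a finite
factor counts as periodic, so the count can only drop. -/
theorem HirschSeries.cyclic {H K : Subgroup G} {n : ℕ} (hHK : H ≤ K)
    [hN : (H.subgroupOf K).Normal] (hcyc : IsCyclic (K ⧸ H.subgroupOf K))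
    (hser : HirschSeries H n) : ∃ m ≤ n + 1, HirschSeries K m := by
  rcases finite_or_infinite (K ⧸ H.subgroupOf K) with hfin | hinf
  · exact ⟨n, n.le_succ, .periodic hHK isOfFinOrder_of_finite hser⟩
  · exact ⟨n + 1, le_rfl, .infiniteCyclic hHK hcyc hinf hser⟩

theorem HirschSeries.comap {f : G →* G'} (hf : Function.Injective f) {K : Subgroup G'} {n : ℕ}
    (hser : HirschSeries K n) : ∃ m ≤ n, HirschSeries (K.comap f) m := by
  have key : ∀ H K : Subgroup G', ∀ _ : (H.subgroupOf K).Normal,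
      ∃ _ : ((H.comap f).subgroupOf (K.comap f)).Normal,
      ∃ φ : K.comap f ⧸ (H.comap f).subgroupOf (K.comap f) →* K ⧸ H.subgroupOf K,
        Function.Injective φ := by
    intro H K hN
    have hker : (H.comap f).subgroupOf (K.comap f) =
        (H.subgroupOf K).comap (f.subgroupComap K) := by
      ext x; rfl
    have hN' : ((H.comap f).subgroupOf (K.comap f)).Normal := by
      rw [hker]; infer_instance
    refine ⟨hN', QuotientGroup.map _ _ (f.subgroupComap K) hker.le, ?_⟩
    rw [← MonoidHom.ker_eq_bot_iff, QuotientGroup.ker_map, ← hker,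
      QuotientGroup.map_mk'_self]
  induction hser with
  | bot =>
    refine ⟨0, le_rfl, ?_⟩
    rw [MonoidHom.comap_bot, (MonoidHom.ker_eq_bot_iff f).2 hf]
    exact .bot
  | @periodic H K n hHK hN htor _ ih =>
    obtain ⟨m, hm, ih⟩ := ih
    obtain ⟨_, φ, hφ⟩ := key H K hN
    exact ⟨m, hm, .periodic (Subgroup.comap_mono hHK) (.of_injective hφ htor) ih⟩
  | @infiniteCyclic H K n hHK hN hcyc _ _ ih =>
    obtain ⟨m, hm, ih⟩ := ih
    obtain ⟨_, φ, hφ⟩ := key H K hN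
    obtain ⟨l, hl, h⟩ := ih.cyclic (Subgroup.comap_mono hHK) (isCyclic_of_injective φ hφ)
    exact ⟨l, by omega, h⟩

theorem HirschSeries.map (f : G →* G') {K : Subgroup G} {n : ℕ}
    (hser : HirschSeries K n) : ∃ m ≤ n, HirschSeries (K.map f) m := by
  have key : ∀ H K : Subgroup G, H ≤ K → ∀ _ : (H.subgroupOf K).Normal,
      ∃ _ : ((H.map f).subgroupOf (K.map f)).Normal,
      ∃ φ : K ⧸ H.subgroupOf K →* K.map f ⧸ (H.map f).subgroupOf (K.map f),
        Function.Surjective φ := by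
    intro H K hHK hN
    have hsurj := f.subgroupMap_surjective K
    have hmap : (H.subgroupOf K).map (f.subgroupMap K) = (H.map f).subgroupOf (K.map f) := by
      ext ⟨x, hx⟩
      simp only [Subgroup.mem_map, Subgroup.mem_subgroupOf]
      constructor
      · rintro ⟨y, hy, h⟩
        exact ⟨y, hy, congrArg Subtype.val h⟩
      · rintro ⟨y, hy, h⟩
        exact ⟨⟨y, hHK hy⟩, hy, Subtype.ext h⟩
    have hN' : ((H.map f).subgroupOf (K.map f)).Normal := hmap ▸ hN.map _ hsurj
    refine ⟨hN', QuotientGroup.map _ _ (f.subgroupMap K) (Subgroup.map_le_iff_le_comap.1 hmap.le),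
      ?_⟩
    exact QuotientGroup.map_surjective_of_surjective _ _ _
      ((QuotientGroup.mk'_surjective _).comp hsurj) _
  induction hser with
  | bot =>
    refine ⟨0, le_rfl, ?_⟩
    rw [Subgroup.map_bot]
    exact .bot
  | @periodic H K n hHK hN htor _ ih =>
    obtain ⟨m, hm, ih⟩ := ih
    obtain ⟨_, φ, hφ⟩ := key H K hHK hN
    exact ⟨m, hm, .periodic (Subgroup.map_mono hHK) (.of_surjective hφ htor) ih⟩
  | @infiniteCyclic H K n hHK hN hcyc _ _ ih =>
    obtain ⟨m, hm, ih⟩ := ih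
    obtain ⟨_, φ, hφ⟩ := key H K hHK hN
    obtain ⟨l, hl, h⟩ := ih.cyclic (Subgroup.map_mono hHK) (isCyclic_of_surjective φ hφ)
    exact ⟨l, by omega, h⟩

theorem hirschLength_le_of_forall
    (h : ∀ n, HirschSeries (⊤ : Subgroup G') n → ∃ m ≤ n, HirschSeries (⊤ : Subgroup G) m) :
    hirschLength G ≤ hirschLength G' := by
  refine le_iInf₂ fun n hn => ?_
  obtain ⟨m, hm, hs⟩ := h n hn
  exact (iInf₂_le m hs).trans (by exact_mod_cast hm)

theorem hirschLength_le_of_injective {f : G →* G'} (hf : Function.Injective f) :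
    hirschLength G ≤ hirschLength G' :=
  hirschLength_le_of_forall fun _ hn => by simpa using hn.comap hf

theorem hirschLength_le_of_surjective {f : G →* G'} (hf : Function.Surjective f) :
    hirschLength G' ≤ hirschLength G :=
  hirschLength_le_of_forall fun _ hn => by
    simpa [← MonoidHom.range_eq_map, MonoidHom.range_eq_top.2 hf] using hn.map f

/-- `f` factors through the range of `g`, which makes `G` a subquotient of `G'`. -/
theorem hirschLength_le_of_ker_le {Z : Type u} [Group Z] {f : Z →* G} (hf : Function.Surjective f)
    (g : Z →* G') (h : g.ker ≤ f.ker) : hirschLength G ≤ hirschLength G' := by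
  have hker : g.rangeRestrict.ker ≤ f.ker := g.ker_rangeRestrict.trans_le h
  let φ : g.range →* G :=
    g.rangeRestrict.liftOfSurjective g.rangeRestrict_surjective ⟨f, hker⟩
  have hφ : Function.Surjective φ := fun y => by
    obtain ⟨z, rfl⟩ := hf y
    exact ⟨g.rangeRestrict z, MonoidHom.liftOfRightInverse_comp_apply _ _ _ ⟨f, hker⟩ z⟩
  exact (hirschLength_le_of_surjective hφ).trans
    (hirschLength_le_of_injective g.range.subtype_injective)

theorem hirschLength_eq_zero_of_finite [Finite G] : hirschLength G = 0 :=
  le_zero_iff.1 <| iInf₂_le_of_le 0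
    (HirschSeries.periodic bot_le isOfFinOrder_of_finite .bot) Nat.cast_zero.le

/-- The equation forces finiteness: if h(G) = ⊤ the left side is ⊥ but the right side is
nonnegative; if only h(G ⊗ G) = ⊤ the left side is ⊤ but the right side is real. -/
theorem hirschLength_tensorSquare_of_growth (c : ℕ)
    (hf : tensorSquareGrowth G = (c : EReal) * ((hirschLength G : ENNReal) : EReal)) :
    hirschLength (NonabelianTensorSquare G) = ((c : ℕ∞) + 1) * hirschLength G := by
  unfold tensorSquareGrowth at hf
  have aux : ∀ n : ℕ, (((n : ℕ∞) : ENNReal) : EReal) = ((n : ℝ) : EReal) := fun n => rfl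
  have aux_top : (((⊤ : ℕ∞) : ENNReal) : EReal) = ⊤ := rfl
  have hc : (c : EReal) = ((c : ℝ) : EReal) := rfl
  rcases eq_or_ne (hirschLength G) ⊤ with h | h
  · exfalso
    rw [h, aux_top, EReal.sub_top] at hf
    exact (EReal.bot_lt_zero.trans_le
      (mul_nonneg (a := (c : EReal)) (by rw [hc]; exact_mod_cast c.cast_nonneg) le_top)).ne hf
  obtain ⟨s, hs⟩ := ENat.ne_top_iff_exists.1 h
  rw [← hs, aux, hc, ← EReal.coe_mul] at hf
  rcases eq_or_ne (hirschLength (NonabelianTensorSquare G)) ⊤ with h' | h'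
  · rw [h', aux_top, EReal.top_sub_coe] at hf
    exact absurd hf.symm (EReal.coe_ne_top _)
  obtain ⟨t, ht⟩ := ENat.ne_top_iff_exists.1 h'
  rw [← ht, aux, ← EReal.coe_sub, EReal.coe_eq_coe_iff] at hf
  rw [← hs, ← ht]
  have : t = (c + 1) * s := by
    have : (t : ℝ) = (c + 1) * s := by linarith
    exact_mod_cast this
  exact_mod_cast this

open scoped commutatorElement

/-! ### Commutators in central extensions -/

section CentralExtension

variable {E : Type u} [Group E] {p : E →* G}

theorem commutatorElement_eq_of_map_eq (hp : p.ker ≤ Subgroup.center E) {u v u' v' : E}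
    (hu : p u = p u') (hv : p v = p v') : ⁅u, v⁆ = ⁅u', v'⁆ := by
  have aux : ∀ x y : E, p x = p y → ∃ z ∈ Subgroup.center E, x = z * y := fun x y h =>
    ⟨x * y⁻¹, hp (by simp [MonoidHom.mem_ker, h]), by simp⟩
  obtain ⟨z, hz, rfl⟩ := aux u u' hu
  obtain ⟨w, hw, rfl⟩ := aux v v' hv
  rw [Subgroup.mem_center_iff] at hz hw
  simp only [commutatorElement_def, mul_inv_rev]
  calc z * u' * (w * v') * (u'⁻¹ * z⁻¹) * (v'⁻¹ * w⁻¹)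
      = z * (u' * w) * v' * u'⁻¹ * z⁻¹ * v'⁻¹ * w⁻¹ := by group
    _ = w * (z * (u' * v' * u'⁻¹)) * z⁻¹ * v'⁻¹ * w⁻¹ := by
      rw [hw u', ← mul_assoc z w u', hw z]; group
    _ = w * (u' * v' * u'⁻¹ * v'⁻¹) * w⁻¹ := by rw [← hz]; group
    _ = u' * v' * u'⁻¹ * v'⁻¹ := by rw [← hw]; group

/-- The homomorphism `x ⊗ y ↦ ⁅s x, s y⁆` from the nonabelian tensor square of `G` to the derived
subgroup of a central extension of `G` with section `s`. -/
def tensorSquareToCommutator (hp : p.ker ≤ Subgroup.center E) (s : G → E)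
    (hs : ∀ g, p (s g) = g) : NonabelianTensorSquare G →* commutator E :=
  PresentedGroup.toGroup (f := fun x : G × G =>
    (⟨⁅s x.1, s x.2⁆, Subgroup.commutator_mem_commutator (Subgroup.mem_top _)
      (Subgroup.mem_top _)⟩ : commutator E)) <| by
    rintro r (⟨x, y, z, rfl⟩ | ⟨x, z, t, rfl⟩)
    all_goals
      rw [map_mul, map_inv, mul_inv_eq_one, map_mul]
      simp only [FreeGroup.lift_apply_of]
      refine Subtype.ext ?_
      simp only [Subgroup.coe_mul]
    -- The section need not be multiplicative, but lifts of the same element give the same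
    -- commutators; what remains is a commutator identity valid in any group.
    · rw [commutatorElement_eq_of_map_eq hp (u := s (x * y)) (u' := s x * s y)
          (v := s z) (v' := s z) (by simp [hs]) rfl,
        commutatorElement_eq_of_map_eq hp (u := s (x * y * x⁻¹)) (u' := s x * s y * (s x)⁻¹)
          (v := s (x * z * x⁻¹)) (v' := s x * s z * (s x)⁻¹) (by simp [hs]) (by simp [hs])]
      simp only [commutatorElement_def]
      group
    · rw [commutatorElement_eq_of_map_eq hp (v := s (z * t)) (v' := s z * s t)
          (u := s x) (u' := s x) rfl (by simp [hs]),
        commutatorElement_eq_of_map_eq hp (u := s (z * x * z⁻¹)) (u' := s z * s x * (s z)⁻¹)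
          (v := s (z * t * z⁻¹)) (v' := s z * s t * (s z)⁻¹) (by simp [hs]) (by simp [hs])]
      simp only [commutatorElement_def]
      group

theorem tensorSquareToCommutator_surjective (hp : p.ker ≤ Subgroup.center E) (s : G → E)
    (hs : ∀ g, p (s g) = g) : Function.Surjective (tensorSquareToCommutator hp s hs) := by
  have h : commutator E ≤
      ((commutator E).subtype.comp (tensorSquareToCommutator hp s hs)).range := by
    refine (commutator_eq_closure E).trans_le ((Subgroup.closure_le _).2 ?_)
    rintro _ ⟨u, v, rfl⟩
    refine ⟨PresentedGroup.of (p u, p v), ?_⟩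
    simp only [tensorSquareToCommutator, MonoidHom.comp_apply, PresentedGroup.toGroup.of]
    exact commutatorElement_eq_of_map_eq hp (hs _) (hs _)
  rintro ⟨x, hx⟩
  obtain ⟨t, ht⟩ := h hx
  exact ⟨t, Subtype.ext ht⟩

theorem hirschLength_commutator_le (hp : p.ker ≤ Subgroup.center E)
    (hsurj : Function.Surjective p) :
    hirschLength (commutator E) ≤ hirschLength (NonabelianTensorSquare G) :=
  hirschLength_le_of_surjective
    (tensorSquareToCommutator_surjective hp _ (Function.surjInv_eq hsurj))

end CentralExtension

/-- The central extension of `G` by the trivial module `A` defined by a function `c` on pairs,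
which is a group if `c` is a 2-cocycle. -/
@[ext]
structure CocycleExtension {G A : Type u} (c : G → G → A) : Type u where
  fst : A
  snd : G

namespace CocycleExtension

variable {A : Type u} [AddCommGroup A] {c : G → G → A}

/-- The group structure on the extension defined by a 2-cocycle. -/
abbrev group (hc : ∀ g h k, c h k + c g (h * k) = c (g * h) k + c g h) :
    Group (CocycleExtension c) :=
  letI : Mul (CocycleExtension c) := ⟨fun x y => ⟨x.fst + y.fst + c x.snd y.snd, x.snd * y.snd⟩⟩
  -- The cocycle is not assumed normalized, hence the correction by `c 1 1`.
  letI : One (CocycleExtension c) := ⟨⟨-c 1 1, 1⟩⟩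
  letI : Inv (CocycleExtension c) :=
    ⟨fun x => ⟨-x.fst - c x.snd⁻¹ x.snd - c 1 1, x.snd⁻¹⟩⟩
  Group.ofLeftAxioms
    (fun x y z => CocycleExtension.ext
      (by
        change x.fst + y.fst + c x.snd y.snd + z.fst + c (x.snd * y.snd) z.snd =
          x.fst + (y.fst + z.fst + c y.snd z.snd) + c x.snd (y.snd * z.snd)
        have := hc x.snd y.snd z.snd
        calc _ = x.fst + y.fst + z.fst + (c (x.snd * y.snd) z.snd + c x.snd y.snd) := by abel
          _ = _ := by rw [← this]; abel)
      (mul_assoc _ _ _))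
    (fun x => CocycleExtension.ext
      (by
        change -c 1 1 + x.fst + c 1 x.snd = x.fst
        have := hc 1 1 x.snd
        simp only [one_mul] at this
        rw [add_left_cancel this]
        abel)
      (one_mul _))
    (fun x => CocycleExtension.ext
      (by
        change -x.fst - c x.snd⁻¹ x.snd - c 1 1 + x.fst + c x.snd⁻¹ x.snd = -c 1 1
        abel)
      (inv_mul_cancel _))

end CocycleExtension

/-! ### The universal extension and the second homology -/

open groupHomology Finsupp

/-- The trivial representation of `G` on the integers, lifted to the universe of `G`. -/
abbrev trivialIntRep (G : Type u) [Group G] : Rep (ULift.{u} ℤ) G :=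
  Rep.trivial (ULift.{u} ℤ) G (ULift.{u} ℤ)

/-- The universal 2-cocycle of `G`, with values in the 2-chains modulo the 2-boundaries. -/
noncomputable def universalCocycle (g h : G) : (G × G →₀ trivialIntRep G) ⧸ boundaries₂ (trivialIntRep G) :=
  Submodule.Quotient.mk (single (g, h) (1 : ULift.{u} ℤ))

theorem universalCocycle_isCocycle (g h k : G) :
    universalCocycle h k + universalCocycle g (h * k) =
      universalCocycle (g * h) k + universalCocycle g h := by
  unfold universalCocycle
  rw [← Submodule.Quotient.mk_add, ← Submodule.Quotient.mk_add, Submodule.Quotient.eq]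
  refine ⟨single (g, h, k) (1 : ULift.{u} ℤ), ?_⟩
  refine (d₃₂_single (A := trivialIntRep G) (g, h, k) (1 : ULift.{u} ℤ)).trans ?_
  have hρ : (trivialIntRep G).ρ g⁻¹ (1 : ULift.{u} ℤ) = (1 : ULift.{u} ℤ) := rfl
  rw [hρ]
  abel

/-- The central extension of `G` defined by the universal 2-cocycle. -/
abbrev UniversalExtension (G : Type u) [Group G] : Type u :=
  CocycleExtension (universalCocycle (G := G))

namespace UniversalExtension

noncomputable instance : Group (UniversalExtension G) := CocycleExtension.group universalCocycle_isCocycle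

theorem mul_def (x y : UniversalExtension G) :
    x * y = ⟨x.fst + y.fst + universalCocycle x.snd y.snd, x.snd * y.snd⟩ := rfl

theorem universalCocycle_one_left (g : G) : universalCocycle 1 g = universalCocycle 1 1 := by
  have := universalCocycle_isCocycle 1 1 g
  simp only [one_mul] at this
  exact add_left_cancel this

theorem universalCocycle_one_right (g : G) : universalCocycle g 1 = universalCocycle 1 1 := by
  have := universalCocycle_isCocycle g 1 1
  simp only [mul_one] at this
  exact (add_right_cancel this).symm

/-- The projection of the universal extension onto `G`. -/
noncomputable def proj (G : Type u) [Group G] : UniversalExtension G →* G where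
  toFun := CocycleExtension.snd
  map_one' := rfl
  map_mul' _ _ := rfl

theorem proj_surjective : Function.Surjective (proj G) := fun g => ⟨⟨0, g⟩, rfl⟩

theorem ker_proj_le_center : (proj G).ker ≤ Subgroup.center (UniversalExtension G) := by
  rintro ⟨a, g⟩ (rfl : g = 1)
  rw [Subgroup.mem_center_iff]
  rintro ⟨b, h⟩
  simp only [mul_def, mul_one, one_mul, universalCocycle_one_left h, universalCocycle_one_right h,
    add_comm a b]

/-- The inclusion of the kernel into the universal extension. -/
noncomputable def incl (G : Type u) [Group G] :
    Multiplicative ((G × G →₀ trivialIntRep G) ⧸ boundaries₂ (trivialIntRep G)) →*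
      UniversalExtension G where
  toFun a := ⟨a.toAdd - universalCocycle 1 1, 1⟩
  map_one' := CocycleExtension.ext (zero_sub _) rfl
  map_mul' a b := by
    simp only [mul_def, toAdd_mul, mul_one]
    congr 1
    abel

theorem incl_injective : Function.Injective (incl G) := fun _ _ h =>
  Multiplicative.toAdd.injective (sub_left_injective (congrArg CocycleExtension.fst h))

theorem incl_universalCocycle_mul (g h : G) :
    incl G (.ofAdd (universalCocycle g h)) * ⟨0, g * h⟩ =
      (⟨0, g⟩ * ⟨0, h⟩ : UniversalExtension G) := by
  simp [incl, mul_def, universalCocycle_one_left (g * h)]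

/-- The homomorphism from 1-chains to the abelianization of the universal extension that maps
`g` to the class of its standard lift. -/
noncomputable def chainsToAbelianization (G : Type u) [Group G] :
    (G →₀ trivialIntRep G) →+ Additive (Abelianization (UniversalExtension G)) :=
  Finsupp.liftAddHom fun g =>
    (zmultiplesHom _ (Additive.ofMul (Abelianization.of (⟨0, g⟩ : UniversalExtension G)))).comp
      (AddEquiv.ulift : ULift.{u} ℤ ≃+ ℤ).toAddMonoidHom

theorem chainsToAbelianization_single (g : G) :
    chainsToAbelianization G (single g (1 : ULift.{u} ℤ)) =
      Additive.ofMul (Abelianization.of (⟨0, g⟩ : UniversalExtension G)) := by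
  simp only [chainsToAbelianization, liftAddHom_apply_single]
  exact one_zsmul _

/-- In the abelianization, `incl_universalCocycle_mul` turns the class of the cocycle at (g, h) into
[g] + [h] - [gh], the image of the boundary of the 2-chain (g, h); additivity does the rest. -/
theorem of_incl_mk (x : G × G →₀ trivialIntRep G) :
    Additive.ofMul (Abelianization.of (incl G (.ofAdd (Submodule.Quotient.mk x)))) =
      chainsToAbelianization G (d₂₁ (trivialIntRep G) x) := by
  let φ : (G × G →₀ trivialIntRep G) →+ Additive (Abelianization (UniversalExtension G)) :=
    (Abelianization.of.comp (incl G)).toAdditive.comp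
      (boundaries₂ (trivialIntRep G)).mkQ.toAddMonoidHom
  suffices φ = (chainsToAbelianization G).comp (d₂₁ (trivialIntRep G)).hom.toAddMonoidHom from
    DFunLike.congr_fun this x
  refine Finsupp.addHom_ext fun ⟨g, h⟩ n => ?_
  have hn : (single (g, h) n : G × G →₀ trivialIntRep G) =
      (n : ULift.{u} ℤ).down • single (g, h) (1 : ULift.{u} ℤ) := by
    rw [Finsupp.smul_single]
    congr 1
    exact ULift.ext _ _ (by simp)
  rw [hn, map_zsmul, map_zsmul]
  congr 1
  have hρ : (trivialIntRep G).ρ g⁻¹ (1 : ULift.{u} ℤ) = (1 : ULift.{u} ℤ) := rfl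
  have hd := d₂₁_single (A := trivialIntRep G) (g, h) (1 : ULift.{u} ℤ)
  refine Eq.trans ?_ (congrArg (chainsToAbelianization G) hd).symm
  rw [hρ, map_add, map_sub]
  rw [sub_add_eq_add_sub, eq_sub_iff_add_eq, add_comm (chainsToAbelianization G _)]
  refine (congrArg₂ _ rfl (chainsToAbelianization_single _)).trans (Eq.trans ?_
    (congrArg₂ _ (chainsToAbelianization_single g) (chainsToAbelianization_single h)).symm)
  have := congrArg Abelianization.of (incl_universalCocycle_mul g h)
  rw [map_mul, map_mul] at this
  exact this

theorem incl_mem_commutator {x : G × G →₀ trivialIntRep G} (hx : x ∈ cycles₂ (trivialIntRep G)) :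
    incl G (.ofAdd (Submodule.Quotient.mk x)) ∈ commutator (UniversalExtension G) := by
  rw [← Abelianization.ker_of, MonoidHom.mem_ker]
  have h := of_incl_mk x
  rw [show d₂₁ (trivialIntRep G) x = 0 from hx, map_zero] at h
  exact h

end UniversalExtension

open UniversalExtension

/-- `H₂(G, ℤ)` embeds into the derived subgroup of the universal extension, onto which the
nonabelian tensor square maps. -/
theorem hirschLength_schurMultiplier_le_tensorSquare :
    hirschLength (Multiplicative (SchurMultiplier G)) ≤
      hirschLength (NonabelianTensorSquare G) := by
  refine le_trans ?_ (hirschLength_commutator_le (p := proj G) ker_proj_le_center proj_surjective)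
  let f : Multiplicative (cycles₂ (trivialIntRep G)) →* Multiplicative (SchurMultiplier G) :=
    (H2π (trivialIntRep G)).hom.toAddMonoidHom.toMultiplicative
  let g : Multiplicative (cycles₂ (trivialIntRep G)) →* commutator (UniversalExtension G) :=
    ((incl G).comp (((boundaries₂ (trivialIntRep G)).mkQ.comp
      (cycles₂ (trivialIntRep G)).subtype).toAddMonoidHom.toMultiplicative)).codRestrict _
      fun z => incl_mem_commutator z.toAdd.2
  have hf : Function.Surjective f :=
    (ModuleCat.epi_iff_surjective (H2π (trivialIntRep G))).1 inferInstance
  refine hirschLength_le_of_ker_le hf g fun z hz => ?_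
  have hz' : incl G (.ofAdd (Submodule.Quotient.mk z.toAdd.1)) = 1 := congrArg Subtype.val hz
  have hz'' := (Submodule.Quotient.mk_eq_zero _).1
    (congrArg Multiplicative.toAdd ((map_eq_one_iff _ incl_injective).1 hz'))
  exact (H2π_eq_zero_iff z.toAdd).2 hz''

theorem corollaryc {S : Type u} [Group S] [Group.IsSolvable S] (c : ℕ)
    (hf : tensorSquareGrowth S = (c : EReal) * ((hirschLength S : ENNReal) : EReal)) :
    hirschLength (Multiplicative (SchurMultiplier S)) ≤
        hirschLength S ^ 2 + ((c : ℕ∞) + 1) * hirschLength S ∧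
      (Finite S → hirschLength (Multiplicative (SchurMultiplier S)) =
        hirschLength S ^ 2 + ((c : ℕ∞) + 1) * hirschLength S) := by
  have h := (hirschLength_schurMultiplier_le_tensorSquare (G := S)).trans_eq
    (hirschLength_tensorSquare_of_growth c hf)
  -- The bound (c + 1) h(S) already holds; the square is simply added.
  refine ⟨h.trans le_add_self, fun _ => ?_⟩
  rw [hirschLength_eq_zero_of_finite (G := S)] at h ⊢
  simpa using h
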